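/- Let $G$ be a finite simple graph. The Ore-degree of $G$ is $\theta(G)=\max\{d(u)+d(v): uv\in E(G)\}$ (taken to be $0$ if $G$ has no edges), and the maximum average degree $\mathrm{mad}(G)$ is the maximum of the average degrees of the subgraphs of $G$ with at least one vertex. The distance of two edges is their distance in the line graph of $G$; a strong edge-coloring of $G$ assigns colors to the edges of $G$ such that any two edges at distance $1$ or $2$ get distinct colors, and the strong chromatic index $\chi_s'(G)$ is the minimum number of colors in a strong edge-coloring of $G$. If $\theta(G)\le 8$ and $\mathrm{mad}(G)<\frac{113}{31}$, then $\chi_s'(G)\le 20$. -/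

import Mathlib

namespace SimpleGraph

/-- Two edges see each other if their distance is `1` or `2`, the distance between edges being
the distance between the corresponding vertices of the line graph.
(`SimpleGraph.dist` is `0` between vertices of different components, so that edges in
different components do not see each other.) -/
def EdgeSees {V : Type*} (G : SimpleGraph V) (e e' : G.edgeSet) : Prop :=
  G.lineGraph.dist e e' = 1 ∨ G.lineGraph.dist e e' = 2

/-- A strong edge-coloring: edges that see each other get distinct colors. -/
def IsStrongEdgeColoring {V : Type*} (G : SimpleGraph V) {C : Type*} (f : G.edgeSet → C) : Prop :=
  ∀ e e' : G.edgeSet, G.EdgeSees e e' → f e ≠ f e'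

/-- The strong chromatic index: the minimum number `k` of colors in a strong `k`-edge-coloring
(`⊤` if there is none, which does not happen for a finite graph). -/
noncomputable def strongChromaticIndex {V : Type*} (G : SimpleGraph V) : ℕ∞ :=
  sInf {n : ℕ∞ | ∃ k : ℕ, n = k ∧ ∃ f : G.edgeSet → Fin k, G.IsStrongEdgeColoring f}

open Classical in
/-- The Ore-degree of a finite graph: the maximum of `d(u) + d(v)` over the edges `uv`
(`0` for a graph without edges). -/
noncomputable def oreDegree {V : Type*} [Fintype V] (G : SimpleGraph V) : ℕ :=
  sSup {n : ℕ | ∃ u v : V, G.Adj u v ∧ n = G.degree u + G.degree v}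

open Classical in
/-- The average degree of a finite graph. -/
noncomputable def averageDegree {V : Type*} [Fintype V] (G : SimpleGraph V) : ℝ :=
  (∑ v : V, (G.degree v : ℝ)) / (Fintype.card V : ℝ)

open Classical in
/-- The maximum average degree of a finite graph: the maximum of the average degrees of its
subgraphs with at least one vertex (a maximum over a finite set). -/
noncomputable def maxAverageDegree {V : Type*} [Fintype V] (G : SimpleGraph V) : ℝ :=
  ⨆ H : {H : G.Subgraph // H.verts.Nonempty}, averageDegree H.1.coe

end SimpleGraph

/-!
Order the subgraphs of `G` by their number of edges and let `G` be a smallest one without a strong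
edge-coloring with `20` colors. Deleting all edges at a vertex `v` leaves a colorable graph, and its
coloring remains valid as a partial coloring of `G`, since two remaining edges cannot be joined by
an edge at `v`. So `G` is critical (`IsCritical`), and the edges at `v` cannot be colored from the
colors that are free for them: Hall's condition fails (`IsCritical.hall`). An edge `uv` sees at most
as many edges as the degrees of the other neighbors of `u` and `v` add up to (`card_seen_le`), and
the Ore-degree bounds these degrees.

Counting alone shows that all non-isolated vertices of `G` have degree three, four or five. Those of
degree five only have neighbors of degree three, and the neighbors of a vertex of degree three have
degrees 355, 444, 445, 455 or 555. Counting also shows that a neighbor of degree four has at most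
one neighbor of degree three in the case 444, and at most two in the case 445. Three further
reductions start from the observation that where Hall's condition just fails, it does so for every
coloring of the remaining edges, so that the edges seen by an uncolored edge have distinct colors in
each of these colorings; then recoloring a single edge is a strong restriction
(`IsPartialColoring.free_subset`):
* a vertex of degree four has at most three neighbors of degree three
  (`IsCritical.numThree_le_three`);
* in the case 445, the two neighbors of degree four do not both have another neighbor of the same
  kind (`IsCritical.false_of_two_chains`);
* if a neighbor of degree five of `v` is also adjacent to `x`, and `v` is of the kind 355, then `x`
  is of the kind 555 (`IsCritical.degree_eq_five_of_adj`).

Discharging finishes the proof: give a vertex of degree `d` the charge `31 * d - 113` and let the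
vertices of degree four and five send charge to their neighbors of degree three as described by
`transfer`. No vertex is left with negative charge, so the non-isolated vertices of `G` have average
degree at least `113 / 31` (`IsCritical.card_support_le_sum_degree`), contrary to the bound on the
maximum average degree.
-/

namespace SimpleGraph

open scoped Classical

variable {V : Type*} [Fintype V] {G : SimpleGraph V}
variable {U : Finset (Sym2 V)} {f : Sym2 V → Fin 20} {e g : Sym2 V}

/-! ### Partial colorings -/

/-- Two distinct edges which share an endpoint or are joined by an edge of `G`. -/
def Sees (G : SimpleGraph V) (e e' : Sym2 V) : Prop :=
  e ≠ e' ∧ ∃ u ∈ e, ∃ w ∈ e', u = w ∨ G.Adj u w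

/-- `f` is a strong edge-coloring of `G` with `20` colors in which the edges of `U` count as
uncolored. Edges are identified with unordered pairs, and the values of `f` outside the edges
of `G` not in `U` are irrelevant. -/
def IsPartialColoring (G : SimpleGraph V) (U : Finset (Sym2 V)) (f : Sym2 V → Fin 20) : Prop :=
  ∀ e ∈ G.edgeSet, e ∉ U → ∀ e' ∈ G.edgeSet, e' ∉ U → G.Sees e e' → f e ≠ f e'

/-- The edges outside `U` that are seen by `e`. -/
noncomputable def seen (G : SimpleGraph V) (U : Finset (Sym2 V)) (e : Sym2 V) : Finset (Sym2 V) :=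
  {e' ∈ G.edgeFinset | e' ∉ U ∧ G.Sees e e'}

/-- The colors available for `e`: those not used on the colored edges that `e` sees. -/
noncomputable def free (G : SimpleGraph V) (U : Finset (Sym2 V)) (f : Sym2 V → Fin 20)
    (e : Sym2 V) : Finset (Fin 20) :=
  ((G.seen U e).image f)ᶜ

/-- The number of edges at `w` outside `U`. -/
noncomputable def degreeOff (G : SimpleGraph V) (U : Finset (Sym2 V)) (w : V) : ℕ :=
  (G.incidenceFinset w \ U).card

/-- The features of a minimal counterexample that the reductions use: Ore-degree at most `8`, no
strong edge-coloring with `20` colors, but one of all edges that avoid any given non-isolated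
vertex. -/
structure IsCritical (G : SimpleGraph V) : Prop where
  degree_add_le : ∀ u v, G.Adj u v → G.degree u + G.degree v ≤ 8
  not_colorable : ∀ f, ¬ G.IsPartialColoring ∅ f
  exists_coloring : ∀ v, 0 < G.degree v → ∃ f, G.IsPartialColoring (G.incidenceFinset v) f

omit [Fintype V] in
lemma Sees.symm {e e' : Sym2 V} (h : G.Sees e e') : G.Sees e' e := by
  obtain ⟨hne, u, hu, w, hw, h⟩ := h
  exact ⟨hne.symm, w, hw, u, hu, h.imp Eq.symm fun h => h.symm⟩

lemma mem_seen : g ∈ G.seen U e ↔ g ∈ G.edgeSet ∧ g ∉ U ∧ G.Sees e g := by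
  simp [seen]

lemma mem_free {y : Fin 20} : y ∈ G.free U f e ↔ ∀ g ∈ G.seen U e, f g ≠ y := by
  simp [free]

lemma le_card_free (k : ℕ) (h : (G.seen U e).card + k ≤ 20) : k ≤ (G.free U f e).card := by
  have := Finset.card_image_le (s := G.seen U e) (f := f)
  rw [free, Finset.card_compl, Fintype.card_fin]
  omega

omit [Fintype V] in
lemma IsPartialColoring.mono {U' : Finset (Sym2 V)} (hf : G.IsPartialColoring U f)
    (h : U ⊆ U') : G.IsPartialColoring U' f :=
  fun e he heU e' he' heU' => hf e he (fun h' => heU (h h')) e' he' (fun h' => heU' (h h'))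

/-- A colored edge may be given any color that is free for it. -/
lemma IsPartialColoring.update (hf : G.IsPartialColoring U f) {y : Fin 20}
    (hy : y ∈ G.free U f g) : G.IsPartialColoring U (Function.update f g y) := by
  rw [mem_free] at hy
  intro e he heU e' he' heU' hs
  by_cases h1 : e = g
  · subst h1
    rw [Function.update_self, Function.update_of_ne hs.1.symm]
    exact (hy e' (mem_seen.2 ⟨he', heU', hs⟩)).symm
  · by_cases h2 : e' = g
    · subst h2
      rw [Function.update_self, Function.update_of_ne h1]
      exact hy e (mem_seen.2 ⟨he, heU, hs.symm⟩)
    · rw [Function.update_of_ne h1, Function.update_of_ne h2]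
      exact hf e he heU e' he' heU' hs

/-- The uncolored edges of a critical graph have no system of distinct free colors, so that
Hall's condition fails for them. -/
lemma IsCritical.hall (hG : G.IsCritical) (hf : G.IsPartialColoring U f) :
    ∃ S ⊆ U, (S.biUnion (G.free U f)).card < S.card := by
  by_contra! hcon
  have key := (Finset.all_card_le_biUnion_card_iff_exists_injective
    (fun e : U => G.free U f e)).1 (fun s => by
      have := hcon (s.map ⟨Subtype.val, Subtype.val_injective⟩) (by
        intro e he
        obtain ⟨e', -, rfl⟩ := Finset.mem_map.1 he
        exact e'.2)
      rw [Finset.card_map] at this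
      refine this.trans (Finset.card_le_card ?_)
      intro y hy
      simp only [Finset.mem_biUnion, Finset.mem_map] at hy ⊢
      obtain ⟨_, ⟨e', he', rfl⟩, hy⟩ := hy
      exact ⟨e', he', hy⟩)
  obtain ⟨c, hinj, hc⟩ := key
  refine hG.not_colorable (fun e => if h : e ∈ U then c ⟨e, h⟩ else f e) ?_
  intro e he _ e' he' _ hs
  by_cases h1 : e ∈ U <;> by_cases h2 : e' ∈ U <;> simp only [h1, h2, dif_pos, dif_neg,
    not_false_eq_true]
  · intro h
    exact hs.1 (congrArg Subtype.val (hinj h))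
  · exact (mem_free.1 (hc ⟨e, h1⟩) e' (mem_seen.2 ⟨he', h2, hs⟩)).symm
  · exact mem_free.1 (hc ⟨e', h2⟩) e (mem_seen.2 ⟨he, h1, hs.symm⟩)
  · exact hf e he h1 e' he' h2 hs

/-- If every uncolored edge has at least `#U - 1` free colors, then in a critical graph all of
them have the same free colors, exactly `#U - 1` of them. -/
lemma IsCritical.exists_free_eq (hG : G.IsCritical) (hf : G.IsPartialColoring U f) {k : ℕ}
    (hU : U.card ≤ k + 1) (hk : ∀ e ∈ U, (G.seen U e).card + k ≤ 20) :
    ∃ P : Finset (Fin 20), P.card = k ∧ ∀ e ∈ U, G.free U f e = P := by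
  obtain ⟨S, hSU, hS⟩ := hG.hall hf
  have hle : ∀ e ∈ S, G.free U f e ⊆ S.biUnion (G.free U f) :=
    fun e he => Finset.subset_biUnion_of_mem _ he
  have hcard := Finset.card_le_card hSU
  have hkS : k ≤ (S.biUnion (G.free U f)).card := by
    obtain ⟨e, he⟩ : S.Nonempty := Finset.card_pos.1 (by omega)
    exact (le_card_free k (hk e (hSU he))).trans (Finset.card_le_card (hle e he))
  have hSU' : S = U := Finset.eq_of_subset_of_card_le hSU (by omega)
  subst hSU'
  refine ⟨_, by omega, fun e he => Finset.eq_of_subset_of_card_le (hle e he) ?_⟩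
  exact le_trans (by omega) (le_card_free k (hk e he))

lemma card_seen_eq_and_injOn_of_card_free_le {k : ℕ} (h : (G.free U f e).card ≤ k)
    (hk : (G.seen U e).card + k ≤ 20) :
    (G.seen U e).card + k = 20 ∧ Set.InjOn f (G.seen U e) := by
  have := Finset.card_image_le (s := G.seen U e) (f := f)
  rw [free, Finset.card_compl, Fintype.card_fin] at h
  exact ⟨by omega, Finset.card_image_iff.1 (by omega)⟩

/-- If every partial coloring is injective on the edges seen by `e`, then recoloring one of them
can only use a color that was free for `e`. -/
lemma IsPartialColoring.free_subset (hf : G.IsPartialColoring U f)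
    (hinj : ∀ f', G.IsPartialColoring U f' → Set.InjOn f' (G.seen U e)) (hg : g ∈ G.seen U e) :
    G.free U f g ⊆ insert (f g) (G.free U f e) := by
  intro y hy
  rw [Finset.mem_insert]
  by_contra! hcon
  obtain ⟨hyg, hye⟩ := hcon
  rw [mem_free] at hye
  push Not at hye
  obtain ⟨h, hh, rfl⟩ := hye
  have hne : h ≠ g := fun h' => hyg (by rw [h'])
  exact hne (hinj _ (hf.update hy) hh hg (by
    rw [Function.update_self, Function.update_of_ne hne]))

/-! ### Counting the edges seen by an edge -/

lemma degreeOff_le_degree (U : Finset (Sym2 V)) (w : V) : G.degreeOff U w ≤ G.degree w := by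
  rw [degreeOff, ← G.card_incidenceFinset_eq_degree]
  exact Finset.card_le_card Finset.sdiff_subset

lemma degreeOff_eq_zero {v : V} (h : G.incidenceFinset v ⊆ U) : G.degreeOff U v = 0 := by
  rw [degreeOff, Finset.sdiff_eq_empty_iff_subset.2 h, Finset.card_empty]

lemma degreeOff_add_one_le {v w : V} (h : G.incidenceFinset v ⊆ U) (hvw : G.Adj v w) :
    G.degreeOff U w + 1 ≤ G.degree w := by
  rw [degreeOff, ← G.card_incidenceFinset_eq_degree]
  refine Finset.card_lt_card (Finset.ssubset_iff_of_subset Finset.sdiff_subset |>.2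
    ⟨s(v, w), ?_, ?_⟩)
  · simp [mem_incidenceFinset, incidenceSet, hvw]
  · have : s(v, w) ∈ U := h (by simp [mem_incidenceFinset, incidenceSet, hvw])
    simp [this]

/-- The vertices other than `u` and `v` at which the edges seen by `uv` can be found. -/
noncomputable def around (G : SimpleGraph V) (u v : V) : Finset V :=
  (G.neighborFinset u).erase v ∪ (G.neighborFinset v).erase u

lemma seen_subset_biUnion {u v : V} (huv : G.Adj u v) :
    G.seen U s(u, v) ⊆ (G.around u v).biUnion fun w => G.incidenceFinset w \ U := by
  intro e he
  obtain ⟨heG, heU, hne, x, hx, y, hy, hxy⟩ := mem_seen.1 he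
  have hinc : ∀ w ∈ G.around u v, w ∈ e →
      e ∈ (G.around u v).biUnion fun w => G.incidenceFinset w \ U := by
    intro w hw hwe
    refine Finset.mem_biUnion.2 ⟨w, hw, Finset.mem_sdiff.2 ⟨?_, heU⟩⟩
    rw [mem_incidenceFinset]
    exact ⟨heG, hwe⟩
  have hu : u ∈ e → e ∈ (G.around u v).biUnion fun w => G.incidenceFinset w \ U := by
    intro hue
    obtain ⟨z, rfl⟩ := hue
    refine hinc z ?_ (Sym2.mem_mk_right _ _)
    have : G.Adj u z := heG
    have hzv : z ≠ v := fun h => hne (by rw [h])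
    simp [around, this, hzv]
  have hv : v ∈ e → e ∈ (G.around u v).biUnion fun w => G.incidenceFinset w \ U := by
    intro hve
    obtain ⟨z, rfl⟩ := hve
    refine hinc z ?_ (Sym2.mem_mk_right _ _)
    have : G.Adj v z := heG
    have hzv : z ≠ u := fun h => hne (by rw [h, Sym2.eq_swap])
    simp [around, this, hzv]
  rw [Sym2.mem_iff] at hx
  by_cases hyu : y = u
  · exact hu (hyu ▸ hy)
  by_cases hyv : y = v
  · exact hv (hyv ▸ hy)
  refine hinc y ?_ hy
  rcases hx with rfl | rfl <;> rcases hxy with rfl | hxy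
  · exact absurd rfl hyu
  · simp [around, hxy, hyv]
  · exact absurd rfl hyv
  · simp [around, hxy, hyu]

lemma card_seen_le_sum_around {u v : V} (huv : G.Adj u v) :
    (G.seen U s(u, v)).card ≤ ∑ w ∈ G.around u v, G.degreeOff U w :=
  (Finset.card_le_card (seen_subset_biUnion huv)).trans Finset.card_biUnion_le

lemma sum_around_le (u v : V) (φ : V → ℕ) :
    ∑ w ∈ G.around u v, φ w ≤ ∑ w ∈ (G.neighborFinset u).erase v, φ w +
      ∑ w ∈ (G.neighborFinset v).erase u, φ w := by
  rw [around, ← Finset.sum_union_inter]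
  exact Nat.le_add_right _ _

lemma card_seen_le {u v : V} (huv : G.Adj u v) :
    (G.seen U s(u, v)).card ≤ ∑ w ∈ (G.neighborFinset u).erase v, G.degreeOff U w +
      ∑ w ∈ (G.neighborFinset v).erase u, G.degreeOff U w :=
  (card_seen_le_sum_around huv).trans (sum_around_le u v _)

/-- An edge joining two vertices around `uv` is counted twice in the bound of `card_seen_le`. -/
lemma card_seen_lt {u v p q : V} (huv : G.Adj u v) (hp : p ∈ G.around u v)
    (hq : q ∈ G.around u v) (hpq : G.Adj p q) (hU : s(p, q) ∉ U) :
    (G.seen U s(u, v)).card < ∑ w ∈ (G.neighborFinset u).erase v, G.degreeOff U w +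
      ∑ w ∈ (G.neighborFinset v).erase u, G.degreeOff U w := by
  refine lt_of_lt_of_le ?_ (sum_around_le u v _)
  refine lt_of_le_of_lt (Finset.card_le_card (seen_subset_biUnion huv)) ?_
  have hq' : q ∈ (G.around u v).erase p := Finset.mem_erase.2 ⟨hpq.ne', hq⟩
  rw [← Finset.insert_erase hp, Finset.biUnion_insert,
    Finset.sum_insert (Finset.notMem_erase _ _)]
  have h1 := Finset.card_union_add_card_inter (G.incidenceFinset p \ U)
    (((G.around u v).erase p).biUnion fun w => G.incidenceFinset w \ U)
  have h2 : (((G.around u v).erase p).biUnion fun w => G.incidenceFinset w \ U).card ≤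
    ∑ w ∈ (G.around u v).erase p, G.degreeOff U w := Finset.card_biUnion_le
  have h3 : 0 < ((G.incidenceFinset p \ U) ∩
      (((G.around u v).erase p).biUnion fun w => G.incidenceFinset w \ U)).card := by
    refine Finset.card_pos.2 ⟨s(p, q), Finset.mem_inter.2 ⟨?_, Finset.mem_biUnion.2 ⟨q, hq', ?_⟩⟩⟩
    · simp [mem_incidenceFinset, incidenceSet, hpq, hU]
    · simp [mem_incidenceFinset, incidenceSet, hpq, hU]
  rw [degreeOff]
  omega

/-! ### Vertices of degree three -/

/-- The neighbors of `v` are `a`, `b` and `c`, without repetition. -/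
structure IsNeighborTriple (G : SimpleGraph V) (v a b c : V) : Prop where
  neighborFinset_eq : G.neighborFinset v = {a, b, c}
  ne₁ : a ≠ b
  ne₂ : a ≠ c
  ne₃ : b ≠ c

/-- The number of neighbors of degree three. -/
noncomputable def numThree (G : SimpleGraph V) (v : V) : ℕ :=
  {w ∈ G.neighborFinset v | G.degree w = 3}.card

/-- The sum of the degrees of the neighbors. -/
noncomputable def neighborDegreeSum (G : SimpleGraph V) (v : V) : ℕ :=
  ∑ w ∈ G.neighborFinset v, G.degree w

namespace IsNeighborTriple

variable {v a b c : V}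

lemma swap (h : G.IsNeighborTriple v a b c) : G.IsNeighborTriple v b a c :=
  ⟨by rw [h.1, Finset.insert_comm], h.2.symm, h.4, h.3⟩

lemma rotate (h : G.IsNeighborTriple v a b c) : G.IsNeighborTriple v b c a :=
  ⟨by rw [h.1, Finset.insert_comm, Finset.pair_comm], h.4, h.2.symm, h.3.symm⟩

lemma adj (h : G.IsNeighborTriple v a b c) : G.Adj v a := by
  rw [← mem_neighborFinset, h.1]; simp

lemma eq_or (h : G.IsNeighborTriple v a b c) {w : V} (hw : G.Adj v w) :
    w = a ∨ w = b ∨ w = c := by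
  rw [← mem_neighborFinset, h.1] at hw
  simpa using hw

lemma degree_eq (h : G.IsNeighborTriple v a b c) : G.degree v = 3 := by
  rw [← card_neighborFinset_eq_degree, h.1, Finset.card_eq_three]
  exact ⟨a, b, c, h.2, h.3, h.4, rfl⟩

lemma sum_eq {M : Type*} [AddCommMonoid M] (h : G.IsNeighborTriple v a b c) (φ : V → M) :
    ∑ w ∈ G.neighborFinset v, φ w = φ a + (φ b + φ c) := by
  rw [h.1, Finset.sum_insert (by simp [h.2, h.3]), Finset.sum_pair h.4]

lemma erase_eq (h : G.IsNeighborTriple v a b c) : (G.neighborFinset v).erase a = {b, c} := by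
  rw [h.1, Finset.erase_insert (by simp [h.2, h.3])]

lemma sum_erase_eq (h : G.IsNeighborTriple v a b c) (φ : V → ℕ) :
    ∑ w ∈ (G.neighborFinset v).erase a, φ w = φ b + φ c := by
  rw [h.erase_eq, Finset.sum_pair h.4]

lemma incidenceFinset_eq (h : G.IsNeighborTriple v a b c) :
    G.incidenceFinset v = {s(v, a), s(v, b), s(v, c)} := by
  have h1 := h.adj
  have h2 := h.rotate.adj
  have h3 := h.rotate.rotate.adj
  ext e
  rw [mem_incidenceFinset]
  constructor
  · rintro ⟨he, z, rfl⟩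
    rcases h.eq_or he with rfl | rfl | rfl <;> simp
  · simp only [Finset.mem_insert, Finset.mem_singleton]
    rintro (rfl | rfl | rfl) <;> simp [incidenceSet, *]

lemma card_incidenceFinset (h : G.IsNeighborTriple v a b c) :
    (G.incidenceFinset v).card = 3 := by
  rw [card_incidenceFinset_eq_degree, h.degree_eq]

lemma card_seen_add_two_le (h : G.IsNeighborTriple v a b c) :
    (G.seen (G.incidenceFinset v) s(v, a)).card + 2 ≤
      G.degree b + G.degree c + ∑ w ∈ (G.neighborFinset a).erase v, G.degree w := by
  have h1 := card_seen_le (U := G.incidenceFinset v) h.adj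
  rw [h.sum_erase_eq] at h1
  have h2 := degreeOff_add_one_le (Finset.Subset.refl _) h.rotate.adj
  have h3 := degreeOff_add_one_le (Finset.Subset.refl _) h.rotate.rotate.adj
  have h4 := Finset.sum_le_sum (s := (G.neighborFinset a).erase v)
    fun w _ => degreeOff_le_degree (G := G) (G.incidenceFinset v) w
  omega

end IsNeighborTriple

lemma exists_isNeighborTriple {v : V} (h : G.degree v = 3) :
    ∃ a b c, G.IsNeighborTriple v a b c := by
  rw [← card_neighborFinset_eq_degree, Finset.card_eq_three] at h
  obtain ⟨a, b, c, h1, h2, h3, h⟩ := h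
  exact ⟨a, b, c, h, h1, h2, h3⟩

lemma exists_isNeighborTriple_of_adj {v a : V} (h : G.degree v = 3) (ha : G.Adj v a) :
    ∃ b c, G.IsNeighborTriple v a b c := by
  obtain ⟨x, y, z, h⟩ := exists_isNeighborTriple h
  rcases h.eq_or ha with rfl | rfl | rfl
  exacts [⟨_, _, h⟩, ⟨_, _, h.swap⟩, ⟨_, _, h.rotate.rotate⟩]

lemma sum_erase_degree_le {v a : V} {k : ℕ} (h : ∀ w, G.Adj a w → G.degree w ≤ k)
    (hav : G.Adj a v) :
    ∑ w ∈ (G.neighborFinset a).erase v, G.degree w ≤ (G.degree a - 1) * k := by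
  have := Finset.sum_le_card_nsmul ((G.neighborFinset a).erase v) (fun w => G.degree w) k
    (fun w hw => h w (by simpa using (Finset.mem_erase.1 hw).2))
  rwa [Finset.card_erase_of_mem (by simpa using hav), card_neighborFinset_eq_degree,
    smul_eq_mul] at this

namespace IsCritical

variable {v a b c : V}

lemma degree_le (hG : G.IsCritical) (h : G.Adj v a) : G.degree v ≤ 8 - G.degree a := by
  have := hG.degree_add_le _ _ h
  omega

lemma sum_erase_degree_le (hG : G.IsCritical) (hav : G.Adj a v) :
    ∑ w ∈ (G.neighborFinset a).erase v, G.degree w ≤ (G.degree a - 1) * (8 - G.degree a) :=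
  SimpleGraph.sum_erase_degree_le (fun _ hw => hG.degree_le hw.symm) hav

/-- At a vertex of any other degree the edges could be colored greedily, as each of them sees
fewer than `20` edges. -/
lemma degree_eq_of_pos (hG : G.IsCritical) (hv : 0 < G.degree v) :
    G.degree v = 3 ∨ G.degree v = 4 ∨ G.degree v = 5 := by
  by_contra! hcon
  obtain ⟨f, hf⟩ := hG.exists_coloring v hv
  obtain ⟨S, hSU, hS⟩ := hG.hall hf
  obtain ⟨e, he⟩ : S.Nonempty := Finset.card_pos.1 (by omega)
  have hcard := Finset.card_le_card hSU
  rw [card_incidenceFinset_eq_degree] at hcard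
  have heU := hSU he
  rw [mem_incidenceFinset] at heU
  obtain ⟨heG, a, rfl⟩ := heU
  have hva : G.Adj v a := heG
  have h1 := card_seen_le (U := G.incidenceFinset v) hva
  have h2 := (Finset.sum_le_sum (s := (G.neighborFinset a).erase v)
    fun w _ => degreeOff_le_degree (G := G) (G.incidenceFinset v) w).trans
    (hG.sum_erase_degree_le hva.symm)
  have h3 := Finset.sum_le_card_nsmul ((G.neighborFinset v).erase a)
    (fun w => G.degreeOff (G.incidenceFinset v) w) (7 - G.degree v) (fun w hw => by
      have hw : G.Adj v w := by simpa using (Finset.mem_erase.1 hw).2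
      have := degreeOff_add_one_le (Finset.Subset.refl _) hw
      have := hG.degree_le hw.symm
      omega)
  rw [Finset.card_erase_of_mem (by simpa using hva), card_neighborFinset_eq_degree,
    smul_eq_mul] at h3
  have h4 := hG.degree_add_le _ _ hva
  have h5 : 0 < G.degree a := (G.degree_pos_iff_exists_adj a).2 ⟨v, hva.symm⟩
  have h6 : G.degree v ≤ (G.free (G.incidenceFinset v) f s(v, a)).card := by
    refine le_card_free _ ?_
    have h7 : G.degree v ≤ 7 := by omega
    have h8 : G.degree a ≤ 7 := by omega
    generalize G.degree v = x at *
    generalize G.degree a = y at *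
    interval_cases x <;> interval_cases y <;> omega
  have := Finset.card_le_card (Finset.subset_biUnion_of_mem
    (G.free (G.incidenceFinset v) f) he)
  omega

lemma degree_eq_of_adj (hG : G.IsCritical) (h : G.Adj v a) :
    G.degree v = 3 ∨ G.degree v = 4 ∨ G.degree v = 5 :=
  hG.degree_eq_of_pos ((G.degree_pos_iff_exists_adj v).2 ⟨a, h⟩)

/-- Around a vertex of degree three, at least one of these bounds fails, since otherwise `vc`,
`vb` and `va` could be colored greedily in this order. -/
lemma not_greedy (hG : G.IsCritical) (h : G.IsNeighborTriple v a b c)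
    (ha : G.degree b + G.degree c + ∑ w ∈ (G.neighborFinset a).erase v, G.degree w ≤ 19)
    (hb : G.degree a + G.degree c + ∑ w ∈ (G.neighborFinset b).erase v, G.degree w ≤ 20)
    (hc : G.degree a + G.degree b + ∑ w ∈ (G.neighborFinset c).erase v, G.degree w ≤ 21) :
    False := by
  obtain ⟨f, hf⟩ := hG.exists_coloring v (by rw [h.degree_eq]; norm_num)
  obtain ⟨S, hSU, hS⟩ := hG.hall hf
  have hfree : ∀ e ∈ S, (G.free (G.incidenceFinset v) f e).card < S.card := fun e he =>
    (Finset.card_le_card (Finset.subset_biUnion_of_mem _ he)).trans_lt hS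
  have ha' := le_card_free (G := G) (U := G.incidenceFinset v) (f := f) (e := s(v, a)) 3
    (by have := h.card_seen_add_two_le; omega)
  have hb' := le_card_free (G := G) (U := G.incidenceFinset v) (f := f) (e := s(v, b)) 2
    (by have := h.swap.card_seen_add_two_le; omega)
  have hc' := le_card_free (G := G) (U := G.incidenceFinset v) (f := f) (e := s(v, c)) 1
    (by have := h.rotate.rotate.card_seen_add_two_le; omega)
  have hcard := Finset.card_le_card hSU
  rw [h.card_incidenceFinset] at hcard
  rw [h.incidenceFinset_eq] at hSU
  have haS : s(v, a) ∉ S := fun he => by have := hfree _ he; omega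
  have hSU2 : S ⊆ {s(v, b), s(v, c)} := (Finset.subset_insert_iff_of_notMem haS).1 hSU
  have hcard2 := (Finset.card_le_card hSU2).trans Finset.card_le_two
  have hbS : s(v, b) ∉ S := fun he => by have := hfree _ he; omega
  have hSU1 : S ⊆ {s(v, c)} := (Finset.subset_insert_iff_of_notMem hbS).1 hSU2
  have hcard1 := Finset.card_le_card hSU1
  rw [Finset.card_singleton] at hcard1
  obtain ⟨e, he⟩ : S.Nonempty := Finset.card_pos.1 (by omega)
  have := hfree e he
  rw [Finset.mem_singleton.1 (hSU1 he)] at this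
  omega

/-- A neighbor of degree three of a vertex of degree three forces degree five on the other two
neighbors. -/
lemma degree_eq_five (hG : G.IsCritical) (h : G.IsNeighborTriple v a b c)
    (ha : G.degree a = 3) : G.degree b = 5 ∧ G.degree c = 5 := by
  have h1 := hG.sum_erase_degree_le h.adj.symm
  have h2 := hG.sum_erase_degree_le h.rotate.adj.symm
  have h3 := hG.sum_erase_degree_le h.rotate.rotate.adj.symm
  have h4 := hG.degree_eq_of_adj h.rotate.adj.symm
  have h5 := hG.degree_eq_of_adj h.rotate.rotate.adj.symm
  rw [ha] at h1
  have h6 : ∑ w ∈ (G.neighborFinset b).erase v, G.degree w ≤ 12 := by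
    rcases h4 with h4 | h4 | h4 <;> rw [h4] at h2 <;> omega
  have h7 : ∑ w ∈ (G.neighborFinset c).erase v, G.degree w ≤ 12 := by
    rcases h5 with h5 | h5 | h5 <;> rw [h5] at h3 <;> omega
  by_contra hcon
  apply hG.not_greedy h <;> omega

/-- The bound `(4 - 1) * 4` on the degrees around a vertex of degree four drops by one with every
neighbor of degree three other than `v`. -/
lemma sum_erase_degree_add_numThree_le (hG : G.IsCritical) (hav : G.Adj a v)
    (ha : G.degree a = 4) (hv : G.degree v = 3) :
    ∑ w ∈ (G.neighborFinset a).erase v, G.degree w + G.numThree a ≤ 13 := by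
  have hmem : v ∈ G.neighborFinset a := by simpa using hav
  have h1 := Finset.add_sum_erase _ (fun w => G.degree w) hmem
  have h2 := Finset.sum_le_card_nsmul (G.neighborFinset a)
    (fun w => G.degree w + if G.degree w = 3 then 1 else 0) 4 (fun w hw => by
      have hw : G.Adj a w := by simpa using hw
      have := hG.degree_le hw.symm
      split_ifs <;> omega)
  rw [Finset.sum_add_distrib, ← Finset.card_filter, card_neighborFinset_eq_degree, ha,
    smul_eq_mul] at h2
  rw [numThree]
  omega

/-- Reducing a vertex of degree three all of whose neighbors have degree four. -/
lemma numThree_le_one (hG : G.IsCritical) (h : G.IsNeighborTriple v a b c)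
    (ha : G.degree a = 4) (hb : G.degree b = 4) (hc : G.degree c = 4) : G.numThree a ≤ 1 := by
  have h1 := hG.sum_erase_degree_add_numThree_le h.adj.symm ha h.degree_eq
  have h2 := hG.sum_erase_degree_le h.rotate.adj.symm
  have h3 := hG.sum_erase_degree_le h.rotate.rotate.adj.symm
  rw [hb] at h2
  rw [hc] at h3
  by_contra hcon
  apply hG.not_greedy h <;> omega

/-- Reducing a vertex of degree three whose neighbors have degrees four, four and five. -/
lemma numThree_le_two (hG : G.IsCritical) (h : G.IsNeighborTriple v a b c)
    (ha : G.degree a = 4) (hb : G.degree b = 4) (hc : G.degree c = 5) : G.numThree a ≤ 2 := by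
  have h1 := hG.sum_erase_degree_add_numThree_le h.adj.symm ha h.degree_eq
  have h2 := hG.sum_erase_degree_le h.rotate.adj.symm
  have h3 := hG.sum_erase_degree_le h.rotate.rotate.adj.symm
  rw [hb] at h2
  rw [hc] at h3
  by_contra hcon
  apply hG.not_greedy h.rotate.rotate.swap <;> omega

end IsCritical

/-! ### Reductions by recoloring -/

lemma sum_erase_degreeOff_le {a v x : V} {k : ℕ} (h : ∀ w, G.Adj a w → G.degree w ≤ k)
    (hU : G.incidenceFinset v ⊆ U) (hav : G.Adj a v) (hax : G.Adj a x) (hvx : v ≠ x) :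
    ∑ w ∈ (G.neighborFinset a).erase x, G.degreeOff U w ≤ (G.degree a - 2) * k := by
  have hv : v ∈ (G.neighborFinset a).erase x := by simp [hvx, hav]
  have h1 := Finset.sum_le_card_nsmul (((G.neighborFinset a).erase x).erase v)
    (fun w => G.degreeOff U w) k (fun w hw => (degreeOff_le_degree U w).trans
      (h w (by simpa using (Finset.mem_erase.1 (Finset.mem_erase.1 hw).2).2)))
  rw [Finset.card_erase_of_mem hv, Finset.card_erase_of_mem (by simpa using hax),
    card_neighborFinset_eq_degree, smul_eq_mul, Nat.sub_sub] at h1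
  rwa [← Finset.add_sum_erase _ _ hv, degreeOff_eq_zero hU, zero_add]

lemma card_le_numThree {v : V} {s : Finset V} (hs : ∀ w ∈ s, G.Adj v w ∧ G.degree w = 3) :
    s.card ≤ G.numThree v :=
  Finset.card_le_card fun w hw => by simpa using hs w hw

lemma mk_notMem_incidenceFinset {v p q : V} (hp : p ≠ v) (hq : q ≠ v) :
    s(p, q) ∉ G.incidenceFinset v := by
  rw [mem_incidenceFinset]
  rintro ⟨-, h⟩
  rcases Sym2.mem_iff.1 h with h | h
  exacts [hp h.symm, hq h.symm]

lemma mk_mem_incidenceFinset {v w : V} (h : G.Adj v w) : s(v, w) ∈ G.incidenceFinset v := by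
  rw [mem_incidenceFinset]
  exact ⟨h, Sym2.mem_mk_left _ _⟩

/-- An edge `ax`, where `a` is a neighbor of `v`, is seen by every edge at `v`. -/
lemma mem_seen_of_adj {v z a x : V} (hva : G.Adj v a) (hax : G.Adj a x) (hxv : x ≠ v)
    (hU : s(a, x) ∉ U) : s(a, x) ∈ G.seen U s(v, z) := by
  refine mem_seen.2 ⟨hax, hU, ?_, v, Sym2.mem_mk_left _ _, a, Sym2.mem_mk_left _ _, Or.inr hva⟩
  intro h
  have : v ∈ s(a, x) := h ▸ Sym2.mem_mk_left _ _
  rcases Sym2.mem_iff.1 this with h | h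
  exacts [hva.ne h, hxv h.symm]

namespace IsCritical

variable {v a b c : V}

/-- Let all neighbors of `a` have degree three, and uncolor the edges at one of them, `v`. Its
other neighbors `b` and `c` have degree five, and in every coloring the edges `vb` and `vc` have
the same unique free color. Another edge at `a` has at least four free colors, so it can be
recolored to free a second color for both. -/
lemma numThree_le_three (hG : G.IsCritical) (ha : G.degree a = 4) : G.numThree a ≤ 3 := by
  by_contra hcon
  have hthree : ∀ w, G.Adj a w → G.degree w = 3 := by
    have : {w ∈ G.neighborFinset a | G.degree w = 3} = G.neighborFinset a :=
      Finset.eq_of_subset_of_card_le (Finset.filter_subset _ _) (by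
        rw [card_neighborFinset_eq_degree]; rw [numThree] at hcon; omega)
    intro w hw
    have hw' : w ∈ G.neighborFinset a := by simpa using hw
    rw [← this] at hw'
    exact (Finset.mem_filter.1 hw').2
  obtain ⟨v, hav⟩ := (G.degree_pos_iff_exists_adj a).1 (by omega)
  obtain ⟨b, c, h⟩ := exists_isNeighborTriple_of_adj (hthree v hav) hav.symm
  have hbc : G.degree b = 5 ∧ G.degree c = 5 := by
    have h1 := hG.degree_eq_of_adj h.rotate.adj.symm
    have h2 := hG.degree_eq_of_adj h.rotate.rotate.adj.symm
    have h3 : G.degree b ≠ 3 := fun h' => by have := hG.degree_eq_five h.rotate h'; omega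
    have h4 : G.degree c ≠ 3 := fun h' => by have := hG.degree_eq_five h.rotate.rotate h'; omega
    rcases h1 with h1 | h1 | h1 <;> rcases h2 with h2 | h2 | h2 <;> try omega
    · have := hG.numThree_le_one h ha h1 h2; omega
    · have := hG.numThree_le_two h ha h1 h2; omega
    · have := hG.numThree_le_two h.rotate.rotate.swap ha h2 h1; omega
  obtain ⟨x, hx⟩ : ((G.neighborFinset a).erase v).Nonempty := Finset.card_pos.1 (by
    rw [Finset.card_erase_of_mem (by simpa using hav), card_neighborFinset_eq_degree]; omega)
  obtain ⟨hxv, hax⟩ : x ≠ v ∧ G.Adj a x := by simpa using hx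
  set U := G.incidenceFinset v with hU
  have hsa : (G.seen U s(v, a)).card ≤ 17 := by
    have := h.card_seen_add_two_le
    rw [← hU] at this
    have := hG.sum_erase_degree_add_numThree_le hav ha (hthree v hav)
    omega
  have hsb : (G.seen U s(v, b)).card ≤ 19 := by
    have := h.rotate.card_seen_add_two_le
    rw [← hU] at this
    have := hG.sum_erase_degree_le h.rotate.adj.symm
    simp only [hbc.1] at this
    omega
  have hsc : (G.seen U s(v, c)).card ≤ 19 := by
    have := h.rotate.rotate.card_seen_add_two_le
    rw [← hU] at this
    have := hG.sum_erase_degree_le h.rotate.rotate.adj.symm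
    simp only [hbc.2] at this
    omega
  have hfree : ∀ f, G.IsPartialColoring U f → (G.free U f s(v, b)).card ≤ 1 := by
    intro f hf
    obtain ⟨S, hSU, hS⟩ := hG.hall hf
    have hle : ∀ e ∈ S, (G.free U f e).card < S.card := fun e he =>
      (Finset.card_le_card (Finset.subset_biUnion_of_mem _ he)).trans_lt hS
    have hcard := Finset.card_le_card hSU
    rw [hU, h.card_incidenceFinset] at hcard
    have haS : s(v, a) ∉ S := fun he => by
      have := hle _ he
      have := le_card_free (G := G) (U := U) (f := f) (e := s(v, a)) 3 (by omega)
      omega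
    rw [hU, h.incidenceFinset_eq, Finset.subset_insert_iff_of_notMem haS] at hSU
    have hcard2 := (Finset.card_le_card hSU).trans Finset.card_le_two
    by_cases hbS : s(v, b) ∈ S
    · have := hle _ hbS
      omega
    · rw [Finset.subset_insert_iff_of_notMem hbS] at hSU
      have hcard1 := Finset.card_le_card hSU
      rw [Finset.card_singleton] at hcard1
      obtain ⟨e, he⟩ : S.Nonempty := Finset.card_pos.1 (by omega)
      have := hle e he
      rw [Finset.mem_singleton.1 (hSU he)] at this
      have := le_card_free (G := G) (U := U) (f := f) (e := s(v, c)) 1 (by omega)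
      omega
  obtain ⟨f, hf⟩ := hG.exists_coloring v (by rw [h.degree_eq]; norm_num)
  rw [← hU] at hf
  have hsub := hf.free_subset (e := s(v, b)) (g := s(a, x))
    (fun f' hf' => (card_seen_eq_and_injOn_of_card_free_le (hfree f' hf') (by omega)).2)
    (mem_seen_of_adj hav.symm hax hxv (mk_notMem_incidenceFinset hav.ne hxv))
  have hsx : (G.seen U s(a, x)).card ≤ 16 := by
    have h1 := card_seen_le (U := U) hax
    have h2 := sum_erase_degreeOff_le (k := 3) (fun w hw => (hthree w hw).le)
      (Finset.Subset.refl U) hav hax hxv.symm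
    have h3 := (Finset.sum_le_sum (s := (G.neighborFinset x).erase a)
      fun w _ => degreeOff_le_degree (G := G) U w).trans (hG.sum_erase_degree_le hax.symm)
    rw [ha] at h2
    rw [hthree x hax] at h3
    omega
  have := Finset.card_le_card hsub
  have := Finset.card_insert_le (f s(a, x)) (G.free U f s(v, b))
  have := hfree f hf
  have := le_card_free (G := G) (U := U) (f := f) (e := s(a, x)) 4 (by omega)
  omega

/-- The neighbors of `a'` (and those of `b'`) have degrees four, four and five, like those of `v`.
Uncolor the edges at `v`. In every coloring the three of them have the same two free colors,
and both of these are free for `aa'` and for `bb'`. As `aa'` and `bb'` do not see each other, they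
may get the same color, which frees a third color for the edges at `v`. -/
lemma false_of_two_chains (hG : G.IsCritical) (h : G.IsNeighborTriple v a b c)
    (ha : G.degree a = 4) (hb : G.degree b = 4) (hc : G.degree c = 5) {a' b' : V}
    (haa' : G.Adj a a') (hbb' : G.Adj b b') (hav' : a' ≠ v) (hbv' : b' ≠ v)
    (ha' : G.degree a' = 3) (hb' : G.degree b' = 3)
    (hsa' : G.neighborDegreeSum a' = 13) (hsb' : G.neighborDegreeSum b' = 13) : False := by
  have hv := h.degree_eq
  have hva := h.adj
  have hvb := h.swap.adj
  have hvc := h.rotate.rotate.adj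
  have hta := hG.numThree_le_two h ha hb hc
  have htb := hG.numThree_le_two h.swap hb ha hc
  have hta' : 2 ≤ G.numThree a := by
    rw [← Finset.card_pair hav']
    exact card_le_numThree (by simp [haa', ha', hva.symm, hv])
  have htb' : 2 ≤ G.numThree b := by
    rw [← Finset.card_pair hbv']
    exact card_le_numThree (by simp [hbb', hb', hvb.symm, hv])
  set U := G.incidenceFinset v with hU
  -- degree bounds that leave each edge at `v` with at most `18` seen edges outside `U`
  have hba := hG.sum_erase_degree_add_numThree_le hva.symm ha hv
  have hbb := hG.sum_erase_degree_add_numThree_le hvb.symm hb hv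
  have hbc := hG.sum_erase_degree_le hvc.symm
  simp only [hc] at hbc
  have hk : ∀ e ∈ U, (G.seen U e).card + 2 ≤ 20 := by
    intro e he
    have h1 := h.card_seen_add_two_le
    have h2 := h.swap.card_seen_add_two_le
    have h3 := h.rotate.rotate.card_seen_add_two_le
    rw [← hU] at h1 h2 h3
    rw [hU, h.incidenceFinset_eq] at he
    simp only [Finset.mem_insert, Finset.mem_singleton] at he
    rcases he with rfl | rfl | rfl <;> omega
  have tight : ∀ f, G.IsPartialColoring U f → ∀ e ∈ U, (G.seen U e).card + 2 = 20 ∧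
      Set.InjOn f (G.seen U e) := by
    intro f hf e he
    obtain ⟨P, hP, hfree⟩ := hG.exists_free_eq hf (h.card_incidenceFinset.le) hk
    exact card_seen_eq_and_injOn_of_card_free_le (by rw [hfree e he, hP]) (hk e he)
  obtain ⟨f, hf⟩ := hG.exists_coloring v (by omega)
  rw [← hU] at hf
  obtain ⟨P, hP, hfree⟩ := hG.exists_free_eq hf (h.card_incidenceFinset.le) hk
  -- the colors free for the edges at `v` are exactly those to which `aa'` and `bb'` can change
  have hPfree : ∀ x y, G.Adj v x → G.Adj x y → y ≠ v → G.degree x = 4 → G.degree y = 3 →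
      G.neighborDegreeSum y = 13 → P ⊆ G.free U f s(x, y) := by
    intro x y hvx hxy hyv hx hy hsy
    have hsub := hf.free_subset (e := s(v, x)) (fun f' hf' =>
      (tight f' hf' _ (mk_mem_incidenceFinset hvx)).2)
      (mem_seen_of_adj hvx hxy hyv (mk_notMem_incidenceFinset hvx.ne' hyv))
    rw [hfree _ (mk_mem_incidenceFinset hvx)] at hsub
    have h1 := card_seen_le (U := U) hxy
    have h2 := sum_erase_degreeOff_le (k := 4) (U := U) (fun w hw => by
      have := hG.degree_le hw.symm; omega) (Finset.Subset.refl U) hvx.symm hxy hyv.symm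
    have h3 := Finset.sum_le_sum (s := (G.neighborFinset y).erase x)
      fun w _ => degreeOff_le_degree (G := G) U w
    have h4 := Finset.add_sum_erase (G.neighborFinset y) (fun w => G.degree w)
      (a := x) (by simpa using hxy.symm)
    rw [neighborDegreeSum] at hsy
    rw [hx] at h2
    have h5 := le_card_free (G := G) (U := U) (f := f) (e := s(x, y)) 3 (by omega)
    have h6 := Finset.eq_of_subset_of_card_le hsub
      ((Finset.card_insert_le _ _).trans (by omega))
    rw [h6]
    exact Finset.subset_insert _ _
  -- `aa'` and `bb'` do not see each other
  have hnab : ¬ G.Adj a b := by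
    intro hab
    have h1 := card_seen_lt (U := U) hvc (p := a) (q := b)
      (by simp [around, hva, h.3]) (by simp [around, hvb, h.4]) hab
      (mk_notMem_incidenceFinset hva.ne' hvb.ne')
    have h2 := (tight f hf _ (mk_mem_incidenceFinset hvc)).1
    have h3 := h.rotate.rotate.sum_erase_eq (fun w => G.degreeOff U w)
    have h4 := degreeOff_add_one_le (Finset.Subset.refl U) hva
    have h5 := degreeOff_add_one_le (Finset.Subset.refl U) hvb
    have h6 := Finset.sum_le_sum (s := (G.neighborFinset c).erase v)
      fun w _ => degreeOff_le_degree (G := G) U w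
    omega
  have hne : a' ≠ b' := by
    rintro rfl
    have h1 := card_seen_lt (U := U) hva (p := b) (q := a')
      (by simp [around, hvb, h.2.symm]) (by simp [around, haa', hav']) hbb'
      (mk_notMem_incidenceFinset hvb.ne' hav')
    have h2 := (tight f hf _ (mk_mem_incidenceFinset hva)).1
    have h3 := h.sum_erase_eq (fun w => G.degreeOff U w)
    have h4 := degreeOff_add_one_le (Finset.Subset.refl U) hvb
    have h5 := degreeOff_add_one_le (Finset.Subset.refl U) hvc
    have h6 := Finset.sum_le_sum (s := (G.neighborFinset a).erase v)
      fun w _ => degreeOff_le_degree (G := G) U w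
    omega
  have hnab' : ¬ G.Adj a b' := by
    intro hab'
    have : ({v, a', b'} : Finset V).card ≤ G.numThree a :=
      card_le_numThree (by simp [haa', ha', hva.symm, hv, hab', hb'])
    rw [Finset.card_eq_three.2 ⟨_, _, _, hav'.symm, hbv'.symm, hne, rfl⟩] at this
    omega
  have hna'b : ¬ G.Adj a' b := by
    intro ha'b
    have : ({v, a', b'} : Finset V).card ≤ G.numThree b :=
      card_le_numThree (by simp [hbb', hb', hvb.symm, hv, ha'b.symm, ha'])
    rw [Finset.card_eq_three.2 ⟨_, _, _, hav'.symm, hbv'.symm, hne, rfl⟩] at this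
    omega
  have hna'b' : ¬ G.Adj a' b' := by
    intro ha'b'
    obtain ⟨x, y, h3⟩ := exists_isNeighborTriple_of_adj ha' ha'b'
    have := hG.degree_eq_five h3 hb'
    rcases h3.eq_or haa'.symm with rfl | rfl | rfl <;> omega
  have hab' : a ≠ b' := by rintro rfl; omega
  have ha'b : a' ≠ b := by rintro rfl; omega
  have hns : ¬ G.Sees s(b, b') s(a, a') := by
    rintro ⟨-, x, hx, y, hy, hxy⟩
    rw [Sym2.mem_iff] at hx hy
    rcases hx with rfl | rfl <;> rcases hy with rfl | rfl <;> rcases hxy with hxy | hxy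
    exacts [h.2 hxy.symm, hnab hxy.symm, ha'b hxy.symm, hna'b hxy.symm, hab' hxy.symm,
      hnab' hxy.symm, hne hxy.symm, hna'b' hxy.symm]
  have hgg : s(a, a') ≠ s(b, b') := by
    intro hgg
    have : a ∈ s(b, b') := hgg ▸ Sym2.mem_mk_left _ _
    rcases Sym2.mem_iff.1 this with h' | h'
    exacts [h.2 h', hab' h']
  obtain ⟨p, hp⟩ : P.Nonempty := Finset.card_pos.1 (by omega)
  have hf1 := hf.update (hPfree a a' hva haa' hav' ha ha' hsa' hp)
  have hf2 := hf1.update (g := s(b, b')) (y := p) (by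
    have := mem_free.1 (hPfree b b' hvb hbb' hbv' hb hb' hsb' hp)
    refine mem_free.2 fun e he => ?_
    have hne : e ≠ s(a, a') := by
      rintro rfl
      exact hns (mem_seen.1 he).2.2
    rw [Function.update_of_ne hne]
    exact this e he)
  exact hgg ((tight _ hf2 _ (mk_mem_incidenceFinset hvc)).2
    (mem_seen_of_adj hva haa' hav' (mk_notMem_incidenceFinset hva.ne' hav'))
    (mem_seen_of_adj hvb hbb' hbv' (mk_notMem_incidenceFinset hvb.ne' hbv'))
    (by rw [Function.update_self, Function.update_of_ne hgg, Function.update_self]))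

/-- Uncolor the edges at two adjacent vertices `v` and `w` of degree three. In every coloring these
five edges have the same four free colors. If `x`, another neighbor of `a`, has a neighbor of
degree less than five, then `ax` can be recolored with one of these. This removes the color from
the list of `va`, but not from those of both edges other than `vw` at `w`. -/
lemma degree_eq_five_of_adj (hG : G.IsCritical) {w x z : V} (h : G.IsNeighborTriple v w a b)
    (hw : G.degree w = 3) (hax : G.Adj a x) (hxv : x ≠ v) (hxz : G.Adj x z) :
    G.degree z = 5 := by
  by_contra hz
  have hv := h.degree_eq
  obtain ⟨ha, hb⟩ := hG.degree_eq_five h hw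
  obtain ⟨c, d, h'⟩ := exists_isNeighborTriple_of_adj hw h.adj.symm
  obtain ⟨hc, hd⟩ := hG.degree_eq_five h' hv
  have hvw := h.adj
  have hva := h.swap.adj
  set U := G.incidenceFinset v ∪ G.incidenceFinset w with hU
  have hUv : G.incidenceFinset v ⊆ U := Finset.subset_union_left
  have hUw : G.incidenceFinset w ⊆ U := Finset.subset_union_right
  have hcard : U.card ≤ 4 + 1 := by
    have h1 := Finset.card_union_add_card_inter (G.incidenceFinset v) (G.incidenceFinset w)
    have h2 : 0 < (G.incidenceFinset v ∩ G.incidenceFinset w).card :=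
      Finset.card_pos.2 ⟨s(v, w), Finset.mem_inter.2 ⟨mk_mem_incidenceFinset hvw, by
        rw [Sym2.eq_swap]; exact mk_mem_incidenceFinset hvw.symm⟩⟩
    rw [h.card_incidenceFinset, h'.card_incidenceFinset, ← hU] at h1
    omega
  have side : ∀ {v w a b : V}, G.IsNeighborTriple v w a b → G.incidenceFinset v ⊆ U →
      G.incidenceFinset w ⊆ U → G.degree a = 5 → G.degree b = 5 →
      (G.seen U s(v, a)).card + 4 ≤ 20 := by
    intro v w a b h hUv hUw ha hb
    have h1 := card_seen_le (U := U) h.swap.adj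
    rw [h.swap.sum_erase_eq, degreeOff_eq_zero hUw] at h1
    have h2 := degreeOff_add_one_le hUv h.rotate.rotate.adj
    have h3 := (Finset.sum_le_sum (s := (G.neighborFinset a).erase v)
      fun w _ => degreeOff_le_degree (G := G) U w).trans
      (hG.sum_erase_degree_le h.swap.adj.symm)
    rw [ha] at h3
    omega
  have hoff : ∀ {v w a b : V}, G.IsNeighborTriple v w a b → G.incidenceFinset v ⊆ U →
      G.degree a = 5 → G.degreeOff U a ≤ 4 := by
    intro v w a b h hUv ha
    have := degreeOff_add_one_le hUv h.swap.adj
    omega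
  have hk : ∀ e ∈ U, (G.seen U e).card + 4 ≤ 20 := by
    have hmid : (G.seen U s(v, w)).card + 4 ≤ 20 := by
      have h1 := card_seen_le (U := U) hvw
      rw [h.sum_erase_eq, h'.sum_erase_eq] at h1
      have := hoff h hUv ha
      have := hoff h.swap.rotate hUv hb
      have := hoff h' hUw hc
      have := hoff h'.swap.rotate hUw hd
      omega
    intro e he
    rw [hU, h.incidenceFinset_eq, h'.incidenceFinset_eq] at he
    simp only [Finset.mem_union, Finset.mem_insert, Finset.mem_singleton] at he
    rcases he with (rfl | rfl | rfl) | (rfl | rfl | rfl)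
    · exact hmid
    · exact side h hUv hUw ha hb
    · exact side h.swap.rotate hUv hUw hb ha
    · rw [Sym2.eq_swap]; exact hmid
    · exact side h' hUw hUv hc hd
    · exact side h'.swap.rotate hUw hUv hd hc
  have tight : ∀ f, G.IsPartialColoring U f → ∀ e ∈ U, (G.seen U e).card + 4 = 20 ∧
      Set.InjOn f (G.seen U e) := by
    intro f hf e he
    obtain ⟨P, hP, hfree⟩ := hG.exists_free_eq hf hcard hk
    exact card_seen_eq_and_injOn_of_card_free_le (by rw [hfree e he, hP]) (hk e he)
  obtain ⟨f, hf⟩ := hG.exists_coloring v (by omega)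
  replace hf := hf.mono hUv
  obtain ⟨P, hP, hfree⟩ := hG.exists_free_eq hf hcard hk
  have hnaw : ¬ G.Adj w a := by
    intro haw
    have h1 := card_seen_le_sum_around (U := U) hvw
    have h2 : G.around v w ⊆ {b, c, d} := by
      rw [around, h.erase_eq, h'.erase_eq]
      rcases h'.eq_or haw with rfl | rfl | rfl
      · exact absurd hva (G.loopless.irrefl _)
      · intro y; simp; tauto
      · intro y; simp; tauto
    have h3 := Finset.sum_le_card_nsmul (G.around v w) (fun w => G.degreeOff U w) 4 (by
      intro y hy
      have hy := h2 hy
      simp only [Finset.mem_insert, Finset.mem_singleton] at hy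
      rcases hy with rfl | rfl | rfl
      exacts [hoff h.swap.rotate hUv hb, hoff h' hUw hc, hoff h'.swap.rotate hUw hd])
    have h4 := (Finset.card_le_card h2).trans Finset.card_le_three
    have h5 := (tight f hf _ (hUv (mk_mem_incidenceFinset hvw))).1
    rw [smul_eq_mul] at h3
    omega
  have hxw : x ≠ w := by rintro rfl; exact hnaw hax.symm
  have haw : a ≠ w := h.2.symm
  have hgU : s(a, x) ∉ U := by
    rw [hU, Finset.mem_union, not_or]
    exact ⟨mk_notMem_incidenceFinset hva.ne' hxv, mk_notMem_incidenceFinset haw hxw⟩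
  have hvaU : s(v, a) ∈ U := hUv (mk_mem_incidenceFinset hva)
  have hgva : s(a, x) ∈ G.seen U s(v, a) := mem_seen_of_adj hva hax hxv hgU
  have hsub := hf.free_subset (fun f' hf' => (tight f' hf' _ hvaU).2) hgva
  rw [hfree _ hvaU] at hsub
  have hxdeg : G.degree x = 3 := by
    have := hG.degree_eq_of_adj hax.symm
    have := hG.degree_le hax.symm
    omega
  obtain ⟨y₁, y₂, hx⟩ := exists_isNeighborTriple_of_adj hxdeg hax.symm
  have hsx : (G.seen U s(a, x)).card ≤ 18 := by
    have h1 := card_seen_le (U := U) hax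
    have h2 := sum_erase_degreeOff_le (k := 3) (fun w hw => by
      have := hG.degree_le hw.symm; omega) hUv hva.symm hax hxv.symm
    rw [hx.sum_erase_eq] at h1
    have h3 := degreeOff_le_degree (G := G) U y₁
    have h4 := degreeOff_le_degree (G := G) U y₂
    have h5 := hG.degree_le hx.rotate.adj.symm
    have h6 := hG.degree_le hx.rotate.rotate.adj.symm
    have h7 : G.degree y₁ + G.degree y₂ ≤ 9 := by
      rcases hx.eq_or hxz with rfl | rfl | rfl <;> omega
    rw [ha] at h2
    omega
  have h2 := le_card_free (G := G) (U := U) (f := f) (e := s(a, x)) 2 (by omega)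
  obtain ⟨y, hy, hyne⟩ :=
    Finset.exists_mem_ne (by omega : 1 < (G.free U f s(a, x)).card) (f s(a, x))
  have hyP : y ∈ P := (Finset.mem_insert.1 (hsub hy)).resolve_left hyne
  have hf' := hf.update hy
  obtain ⟨P', hP', hfree'⟩ := hG.exists_free_eq hf' hcard hk
  -- `y` is no longer free for `va`, hence for no uncolored edge, so each of them sees `ax`
  have hyP' : y ∉ P' := by
    rw [← hfree' _ hvaU, mem_free]
    intro hcon
    exact hcon _ hgva (Function.update_self _ _ _)
  have hall : ∀ e ∈ U, s(a, x) ∈ G.seen U e := by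
    intro e he
    by_contra hcon
    refine hyP' ?_
    rw [← hfree _ he, mem_free] at hyP
    rw [← hfree' _ he, mem_free]
    intro k hk
    have hne : k ≠ s(a, x) := by rintro rfl; exact hcon hk
    rw [Function.update_of_ne hne]
    exact hyP k hk
  have hend : ∀ {c d : V}, G.IsNeighborTriple w v c d → G.degree c = 5 → G.degree d = 5 →
      G.Adj x c := by
    intro c d h' hc hd
    have hs := (mem_seen.1 (hall s(w, c) (hUw (mk_mem_incidenceFinset h'.swap.adj)))).2.2
    obtain ⟨-, p, hp, q, hq, hpq⟩ := hs
    rw [Sym2.mem_iff] at hp hq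
    rcases hp with rfl | rfl <;> rcases hq with rfl | rfl <;> rcases hpq with hpq | hpq
    · exact absurd hpq.symm haw
    · exact absurd hpq hnaw
    · exact absurd hpq.symm hxw
    · rcases h'.eq_or hpq with rfl | rfl | rfl
      · exact absurd rfl hxv
      · omega
      · omega
    · subst hpq; exact absurd h'.swap.adj hnaw
    · have := hG.degree_add_le _ _ hpq; omega
    · subst hpq; omega
    · exact hpq.symm
  have hxc := hend h' hc hd
  have hxd := hend h'.swap.rotate hd hc
  have hca : c ≠ a := by rintro rfl; exact hnaw h'.swap.adj
  have hda : d ≠ a := by rintro rfl; exact hnaw h'.rotate.rotate.adj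
  rcases hx.eq_or hxz with rfl | rfl | rfl <;> rcases hx.eq_or hxc with rfl | rfl | rfl <;>
    rcases hx.eq_or hxd with rfl | rfl | rfl <;>
    first
    | omega
    | exact absurd rfl hca
    | exact absurd rfl hda
    | exact absurd rfl h'.4

end IsCritical

/-! ### Discharging -/

/-- The number of neighbors of degree three whose own neighbors have degree sum `13`; for a vertex
of degree four in a critical graph, the neighbors whose neighbors have degrees four, four, five. -/
noncomputable def numThirteen (G : SimpleGraph V) (u : V) : ℕ :=
  {w ∈ G.neighborFinset u | G.degree w = 3 ∧ G.neighborDegreeSum w = 13}.card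

/-- The charge that `u` sends to its neighbor `v`. Initially the charge of a vertex of degree `d`
is `31 * d - 113`, that is `-20`, `11` and `42` for degrees three, four and five, so only vertices
of degree three need charge. -/
noncomputable def transfer (G : SimpleGraph V) (u v : V) : ℚ :=
  if G.degree v = 3 then
    if G.degree u = 5 then
      if 0 < G.numThree v then 10 else if G.neighborDegreeSum v = 15 then 20 / 3 else 42 / 5
    else if G.degree u = 4 then
      if G.neighborDegreeSum v = 14 then 16 / 5
      else if G.neighborDegreeSum v = 13 then
        if 2 ≤ G.numThirteen u then 11 / 2 else 61 / 10
      else 20 / 3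
    else 0
  else 0

lemma transfer_nonneg (u v : V) : 0 ≤ G.transfer u v := by
  unfold transfer
  split_ifs <;> norm_num

lemma numThree_pos_iff {v : V} : 0 < G.numThree v ↔ ∃ w, G.Adj v w ∧ G.degree w = 3 := by
  simp [numThree, Finset.card_pos, Finset.Nonempty]

lemma IsNeighborTriple.neighborDegreeSum_eq {v a b c : V} (h : G.IsNeighborTriple v a b c) :
    G.neighborDegreeSum v = G.degree a + (G.degree b + G.degree c) :=
  h.sum_eq _

lemma IsNeighborTriple.numThree_eq_zero {v a b c : V} (h : G.IsNeighborTriple v a b c)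
    (ha : G.degree a ≠ 3) (hb : G.degree b ≠ 3) (hc : G.degree c ≠ 3) : G.numThree v = 0 := by
  by_contra hcon
  obtain ⟨w, hw, hw3⟩ := numThree_pos_iff.1 (Nat.pos_of_ne_zero hcon)
  rcases h.eq_or hw with rfl | rfl | rfl <;> contradiction

namespace IsCritical

variable {u v a b c : V}

lemma twenty_le_sum_transfer_of_thirteen (hG : G.IsCritical) (h : G.IsNeighborTriple v a b c)
    (ha : G.degree a = 4) (hb : G.degree b = 4) (hc : G.degree c = 5) :
    20 ≤ ∑ u ∈ G.neighborFinset v, G.transfer u v := by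
  have hs := h.neighborDegreeSum_eq
  rw [ha, hb, hc] at hs
  have h0 := h.numThree_eq_zero (by omega) (by omega) (by omega)
  have hother : ∀ {x}, 2 ≤ G.numThirteen x → ∃ y, G.Adj x y ∧ y ≠ v ∧
      G.degree y = 3 ∧ G.neighborDegreeSum y = 13 := by
    intro x hx2
    obtain ⟨y, hy, hyv⟩ := Finset.exists_mem_ne (Nat.lt_of_succ_le hx2) v
    rw [Finset.mem_filter, mem_neighborFinset] at hy
    exact ⟨y, hy.1, hyv, hy.2⟩
  have hnot : ¬ (2 ≤ G.numThirteen a ∧ 2 ≤ G.numThirteen b) := by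
    rintro ⟨h1, h2⟩
    obtain ⟨a', haa', hav', ha', hsa'⟩ := hother h1
    obtain ⟨b', hbb', hbv', hb', hsb'⟩ := hother h2
    exact hG.false_of_two_chains h ha hb hc haa' hbb' hav' hbv' ha' hb' hsa' hsb'
  rw [h.sum_eq]
  simp only [transfer, h.degree_eq, ha, hb, hc, hs, h0]
  by_cases h1 : 2 ≤ G.numThirteen a <;> by_cases h2 : 2 ≤ G.numThirteen b
  · exact absurd ⟨h1, h2⟩ hnot
  all_goals norm_num [h1, h2]

lemma twenty_le_sum_transfer (hG : G.IsCritical) (hv : G.degree v = 3) :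
    20 ≤ ∑ u ∈ G.neighborFinset v, G.transfer u v := by
  by_cases h0 : 0 < G.numThree v
  · obtain ⟨a, hva, ha⟩ := numThree_pos_iff.1 h0
    obtain ⟨b, c, h⟩ := exists_isNeighborTriple_of_adj hv hva
    obtain ⟨hb, hc⟩ := hG.degree_eq_five h ha
    rw [h.sum_eq]
    norm_num [transfer, hv, ha, hb, hc, h0]
  · obtain ⟨a, b, c, h⟩ := exists_isNeighborTriple hv
    have hne : ∀ w, G.Adj v w → G.degree w = 4 ∨ G.degree w = 5 := by
      intro w hw
      exact (hG.degree_eq_of_adj hw.symm).resolve_left fun h3 =>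
        h0 (numThree_pos_iff.2 ⟨w, hw, h3⟩)
    have hs := h.neighborDegreeSum_eq
    rcases hne a h.adj with ha | ha <;> rcases hne b h.swap.adj with hb | hb <;>
      rcases hne c h.rotate.rotate.adj with hc | hc
    case inl.inl.inr => exact hG.twenty_le_sum_transfer_of_thirteen h ha hb hc
    case inl.inr.inl =>
      exact hG.twenty_le_sum_transfer_of_thirteen h.rotate.rotate hc ha hb
    case inr.inl.inl => exact hG.twenty_le_sum_transfer_of_thirteen h.rotate hb hc ha
    all_goals
      rw [ha, hb, hc] at hs
      rw [h.sum_eq]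
      norm_num [transfer, hv, ha, hb, hc, hs, h0]

lemma sum_transfer_le_of_degree_eq_five (hG : G.IsCritical) (hu : G.degree u = 5) :
    ∑ v ∈ G.neighborFinset u, G.transfer u v ≤ 42 := by
  have hthree : ∀ v, G.Adj u v → G.degree v = 3 := by
    intro v hv
    have := hG.degree_eq_of_adj hv.symm
    have := hG.degree_le hv.symm
    omega
  by_cases hex : ∃ v, G.Adj u v ∧ 0 < G.numThree v
  · obtain ⟨v, huv, hv0⟩ := hex
    obtain ⟨w, hvw, hw⟩ := numThree_pos_iff.1 hv0
    obtain ⟨p, q, h⟩ := exists_isNeighborTriple_of_adj (hthree v huv) hvw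
    obtain ⟨b, h⟩ : ∃ b, G.IsNeighborTriple v w u b := by
      rcases h.eq_or huv.symm with rfl | rfl | rfl
      · omega
      · exact ⟨_, h⟩
      · exact ⟨_, h.swap.rotate⟩
    have hmem : v ∈ G.neighborFinset u := by simpa using huv
    have hle := Finset.sum_le_card_nsmul ((G.neighborFinset u).erase v)
      (fun x => G.transfer u x) (20 / 3) (by
        intro x hx
        obtain ⟨hxv, hux⟩ : x ≠ v ∧ G.Adj u x := by simpa using hx
        have hx5 : ∀ z, G.Adj x z → G.degree z = 5 := fun z hz =>
          hG.degree_eq_five_of_adj h hw hux hxv hz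
        obtain ⟨y₁, y₂, y₃, h3⟩ := exists_isNeighborTriple (hthree x hux)
        have h1 := hx5 _ h3.adj
        have h2 := hx5 _ h3.swap.adj
        have h4 := hx5 _ h3.rotate.rotate.adj
        have hs := h3.neighborDegreeSum_eq
        rw [h1, h2, h4] at hs
        have h0 := h3.numThree_eq_zero (by omega) (by omega) (by omega)
        simp [transfer, hthree x hux, hu, h0, hs])
    rw [Finset.card_erase_of_mem hmem, card_neighborFinset_eq_degree, hu] at hle
    rw [← Finset.add_sum_erase _ _ hmem]
    have h10 : G.transfer u v = 10 := by simp [transfer, hthree v huv, hu, hv0]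
    rw [h10]
    norm_num at hle
    linarith
  · have hle := Finset.sum_le_card_nsmul (G.neighborFinset u)
      (fun x => G.transfer u x) (42 / 5) (by
        intro x hx
        have hux : G.Adj u x := by simpa using hx
        have h0 : ¬ 0 < G.numThree x := fun h => hex ⟨x, hux, h⟩
        simp only [transfer, hthree x hux, hu, h0, if_true, if_false]
        split_ifs <;> norm_num)
    rw [card_neighborFinset_eq_degree, hu] at hle
    norm_num at hle
    linarith

lemma neighborDegreeSum_cases (hG : G.IsCritical) (hu : G.degree u = 4) (hv : G.degree v = 3)
    (huv : G.Adj u v) : (G.neighborDegreeSum v = 12 ∧ G.numThree u ≤ 1) ∨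
      (G.neighborDegreeSum v = 13 ∧ G.numThree u ≤ 2) ∨ G.neighborDegreeSum v = 14 := by
  obtain ⟨b, c, h⟩ := exists_isNeighborTriple_of_adj hv huv.symm
  have hs := h.neighborDegreeSum_eq
  have h1 := hG.degree_eq_of_adj h.rotate.adj.symm
  have h2 := hG.degree_eq_of_adj h.rotate.rotate.adj.symm
  have h3 : G.degree b ≠ 3 := fun h' => by have := hG.degree_eq_five h.rotate h'; omega
  have h4 : G.degree c ≠ 3 := fun h' => by have := hG.degree_eq_five h.rotate.rotate h'; omega
  rcases h1 with h1 | h1 | h1 <;> rcases h2 with h2 | h2 | h2 <;> try omega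
  · have := hG.numThree_le_one h hu h1 h2; omega
  · have := hG.numThree_le_two h hu h1 h2; omega
  · have := hG.numThree_le_two h.rotate.rotate.swap hu h2 h1; omega

lemma sum_transfer_le_of_degree_eq_four (hG : G.IsCritical) (hu : G.degree u = 4) :
    ∑ v ∈ G.neighborFinset u, G.transfer u v ≤ 11 := by
  set T := {v ∈ G.neighborFinset u | G.degree v = 3} with hT
  have hTcard : T.card = G.numThree u := rfl
  have hsum : ∑ v ∈ G.neighborFinset u, G.transfer u v = ∑ v ∈ T, G.transfer u v := by
    rw [hT, Finset.sum_filter]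
    refine Finset.sum_congr rfl fun v _ => ?_
    split_ifs with h
    · rfl
    · simp [transfer, h]
  have hmem : ∀ v ∈ T, G.Adj u v ∧ G.degree v = 3 := fun v hv => by simpa [hT] using hv
  have hcases := fun v hv => hG.neighborDegreeSum_cases hu (hmem v hv).2 (hmem v hv).1
  have h14 : ∀ v ∈ T, G.neighborDegreeSum v = 14 → G.transfer u v = 16 / 5 := fun v hv h => by
    simp [transfer, hu, (hmem v hv).2, h]
  have h13 : ∀ v ∈ T, G.neighborDegreeSum v = 13 →
      G.transfer u v = if 2 ≤ G.numThirteen u then 11 / 2 else 61 / 10 := fun v hv h => by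
    simp [transfer, hu, (hmem v hv).2, h]
  -- at most `k` neighbors of degree three receive at most `t` each
  have hbound : ∀ (k : ℕ) (t : ℚ), 0 ≤ t → G.numThree u ≤ k → (∀ v ∈ T, G.transfer u v ≤ t) →
      ∑ v ∈ T, G.transfer u v ≤ k * t := by
    intro k t ht hk h
    refine (Finset.sum_le_card_nsmul T _ t h).trans ?_
    rw [nsmul_eq_mul, hTcard]
    gcongr
  rw [hsum]
  by_cases h12 : ∃ v ∈ T, G.neighborDegreeSum v = 12
  · obtain ⟨v, hv, hv12⟩ := h12
    have h1 : G.numThree u ≤ 1 := by rcases hcases v hv with h | h | h <;> omega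
    have := hbound 1 (20 / 3) (by norm_num) h1 (fun x _ => by
      simp only [transfer, hu]
      split_ifs <;> norm_num at *)
    norm_num at this
    linarith
  have hcases' : ∀ v ∈ T, G.neighborDegreeSum v = 13 ∨ G.neighborDegreeSum v = 14 := by
    intro v hv
    rcases hcases v hv with h | h | h
    exacts [absurd ⟨v, hv, h.1⟩ h12, Or.inl h.1, Or.inr h]
  by_cases hex : ∃ v ∈ T, G.neighborDegreeSum v = 13
  · obtain ⟨v, hv, hv13⟩ := hex
    have h2 : G.numThree u ≤ 2 := by rcases hcases v hv with h | h | h <;> omega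
    by_cases htwo : 2 ≤ G.numThirteen u
    · have := hbound 2 (11 / 2) (by norm_num) h2 (fun x hx => by
        rcases hcases' x hx with h | h
        · rw [h13 x hx h, if_pos htwo]
        · rw [h14 x hx h]; norm_num)
      norm_num at this
      linarith
    · have hle := Finset.sum_le_card_nsmul (T.erase v) (fun x => G.transfer u x) (16 / 5) (by
        intro x hx
        obtain ⟨hxv, hxT⟩ := Finset.mem_erase.1 hx
        rcases hcases' x hxT with h | h
        · refine absurd ?_ htwo
          rw [← Finset.card_pair hxv]
          refine Finset.card_le_card fun y hy => ?_
          have hx' := hmem x hxT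
          have hv' := hmem v hv
          rcases Finset.mem_insert.1 hy with rfl | hy
          · simp [hx', h]
          · rw [Finset.mem_singleton.1 hy]
            simp [hv', hv13]
        · exact (h14 x hxT h).le)
      have hc : ((T.erase v).card : ℚ) ≤ 1 := by
        rw [Finset.card_erase_of_mem hv, hTcard]
        exact_mod_cast (by omega : G.numThree u - 1 ≤ 1)
      rw [← Finset.add_sum_erase _ _ hv, h13 v hv hv13, if_neg htwo]
      rw [nsmul_eq_mul] at hle
      linarith
  · have := hbound 3 (16 / 5) (by norm_num) (hG.numThree_le_three hu) (fun x hx =>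
      (h14 x hx ((hcases' x hx).resolve_left fun h => hex ⟨x, hx, h⟩)).le)
    norm_num at this
    linarith

/-- After all transfers no vertex has negative charge. -/
lemma final_charge_nonneg (hG : G.IsCritical) (hv : 0 < G.degree v) :
    0 ≤ 31 * (G.degree v : ℚ) - 113 + (∑ u ∈ G.neighborFinset v, G.transfer u v -
      ∑ u ∈ G.neighborFinset v, G.transfer v u) := by
  have hin : 0 ≤ ∑ u ∈ G.neighborFinset v, G.transfer u v :=
    Finset.sum_nonneg fun u _ => transfer_nonneg u v
  rcases hG.degree_eq_of_pos hv with h | h | h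
  · have h1 := hG.twenty_le_sum_transfer h
    have h2 : ∑ u ∈ G.neighborFinset v, G.transfer v u = 0 :=
      Finset.sum_eq_zero fun u _ => by simp [transfer, h]
    rw [h, h2]
    norm_num
    linarith
  · have h1 := hG.sum_transfer_le_of_degree_eq_four h
    rw [h]
    norm_num
    linarith
  · have h1 := hG.sum_transfer_le_of_degree_eq_five h
    rw [h]
    norm_num
    linarith

/-- The non-isolated vertices of a critical graph have average degree at least `113 / 31`. -/
theorem card_support_le_sum_degree (hG : G.IsCritical) :
    113 * {v | 0 < G.degree v}.toFinset.card ≤ 31 * ∑ v, G.degree v := by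
  have hcomm : ∑ v, ∑ u ∈ G.neighborFinset v, G.transfer u v =
      ∑ v, ∑ u ∈ G.neighborFinset v, G.transfer v u :=
    Finset.sum_comm' (by simp [adj_comm])
  have hnonneg : 0 ≤ ∑ v, (31 * (G.degree v : ℚ) - (if 0 < G.degree v then 113 else 0) +
      (∑ u ∈ G.neighborFinset v, G.transfer u v -
        ∑ u ∈ G.neighborFinset v, G.transfer v u)) := by
    refine Finset.sum_nonneg fun v _ => ?_
    split_ifs with hv
    · exact hG.final_charge_nonneg hv
    · have h0 : G.degree v = 0 := by omega
      have : G.neighborFinset v = ∅ := by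
        rw [← Finset.card_eq_zero, card_neighborFinset_eq_degree, h0]
      simp [this, h0]
  rw [Finset.sum_add_distrib, Finset.sum_sub_distrib, Finset.sum_sub_distrib, hcomm, sub_self,
    add_zero, ← Finset.mul_sum, ← Finset.sum_filter, Finset.sum_const, nsmul_eq_mul,
    sub_nonneg] at hnonneg
  have heq : {v | 0 < G.degree v}.toFinset = ({v | 0 < G.degree v} : Finset V) := by
    ext; simp
  rw [heq]
  have : (113 * ({v | 0 < G.degree v} : Finset V).card : ℚ) ≤ 31 * ∑ v, (G.degree v : ℚ) := by
    linarith
  exact_mod_cast this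

end IsCritical

/-! ### Existence of colorings -/

/-- A partial coloring after deleting the edges at `v`: no two of the remaining edges are joined by
a deleted one. -/
lemma IsPartialColoring.of_deleteIncidenceSet {v : V} {f : Sym2 V → Fin 20}
    (hf : (G.deleteEdges (G.incidenceSet v)).IsPartialColoring ∅ f) :
    G.IsPartialColoring (G.incidenceFinset v) f := by
  intro e he heU e' he' heU' ⟨hne, x, hx, y, hy, hxy⟩
  rw [mem_incidenceFinset] at heU heU'
  have hxv : v ≠ x := by rintro rfl; exact heU ⟨he, hx⟩
  have hyv : v ≠ y := by rintro rfl; exact heU' ⟨he', hy⟩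
  refine hf e (by rw [edgeSet_deleteEdges]; exact ⟨he, heU⟩) (Finset.notMem_empty _) e'
    (by rw [edgeSet_deleteEdges]; exact ⟨he', heU'⟩) (Finset.notMem_empty _)
    ⟨hne, x, hx, y, hy, hxy.imp_right fun h => deleteEdges_adj.2 ⟨h, fun h' => ?_⟩⟩
  rcases Sym2.mem_iff.1 h'.2 with h' | h'
  exacts [hxv h', hyv h']

/-- A graph of Ore-degree at most `8` all of whose nonempty subgraphs have average degree less than
`113 / 31` has a strong edge-coloring with `20` colors. -/
theorem exists_isPartialColoring_empty (G : SimpleGraph V)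
    (hore : ∀ u v, G.Adj u v → G.degree u + G.degree v ≤ 8)
    (hdens : ∀ H ≤ G, H ≠ ⊥ →
      31 * ∑ v, H.degree v < 113 * {v | 0 < H.degree v}.toFinset.card) :
    ∃ f, G.IsPartialColoring ∅ f := by
  induction hn : G.edgeFinset.card using Nat.strong_induction_on generalizing G with
  | _ n ih =>
    subst hn
    by_contra! hcon
    have hG : G.IsCritical := by
      refine ⟨hore, hcon, fun v hv => ?_⟩
      obtain ⟨w, hvw⟩ := (G.degree_pos_iff_exists_adj v).1 hv
      obtain ⟨G', hG'⟩ : ∃ G', G' = G.deleteEdges (G.incidenceSet v) := ⟨_, rfl⟩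
      have hle : G' ≤ G := hG' ▸ deleteEdges_le _
      have hlt : G' < G := lt_of_le_of_ne hle fun heq => by
        have h : G'.Adj v w := heq ▸ hvw
        rw [hG', deleteEdges_adj] at h
        exact h.2 ⟨hvw, Sym2.mem_mk_left _ _⟩
      obtain ⟨f, hf⟩ := ih _ (Finset.card_lt_card (edgeFinset_ssubset_edgeFinset.2 hlt)) G'
        (fun x y hxy => (add_le_add (degree_le_of_le hle) (degree_le_of_le hle)).trans
          (hore x y (hle hxy)))
        (fun H hH => hdens H (hH.trans hle)) rfl
      exact ⟨f, IsPartialColoring.of_deleteIncidenceSet (hG' ▸ hf)⟩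
    have hbot : G ≠ ⊥ := by
      rintro rfl
      exact hcon (fun _ => 0) fun e he => by simp at he
    exact (hdens G le_rfl hbot).not_ge hG.card_support_le_sum_degree

lemma degree_add_le_oreDegree {u v : V} (h : G.Adj u v) :
    G.degree u + G.degree v ≤ G.oreDegree := by
  refine le_csSup ⟨Fintype.card V + Fintype.card V, ?_⟩ ⟨u, v, h, rfl⟩
  rintro _ ⟨x, y, -, rfl⟩
  exact add_le_add (G.degree_lt_card_verts x).le (G.degree_lt_card_verts y).le

lemma averageDegree_coe_le_maxAverageDegree (H : G.Subgraph) (hH : H.verts.Nonempty) :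
    averageDegree H.coe ≤ G.maxAverageDegree :=
  le_ciSup (f := fun H : {H : G.Subgraph // H.verts.Nonempty} => averageDegree H.1.coe)
    (Set.finite_range _).bddAbove ⟨H, hH⟩

/-- The bound on the maximum average degree, applied to a spanning subgraph without its isolated
vertices. -/
lemma sum_degree_lt_of_maxAverageDegree_lt (hmad : G.maxAverageDegree < 113 / 31)
    {H : SimpleGraph V} (hH : H ≤ G) (hbot : H ≠ ⊥) :
    31 * ∑ v, H.degree v < 113 * {v | 0 < H.degree v}.toFinset.card := by
  obtain ⟨S, hverts, hadj⟩ : ∃ S : G.Subgraph, (∀ v, v ∈ S.verts ↔ 0 < H.degree v) ∧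
      ∀ v w, S.Adj v w ↔ H.Adj v w :=
    ⟨{ verts := {v | 0 < H.degree v}
       Adj := H.Adj
       adj_sub := fun h => hH h
       edge_vert := fun {v w} h => (H.degree_pos_iff_exists_adj v).2 ⟨w, h⟩
       symm := H.symm }, fun _ => Iff.rfl, fun _ _ => Iff.rfl⟩
  obtain ⟨x, y, hxy⟩ : ∃ x y, H.Adj x y := by
    by_contra! hcon
    exact hbot (by ext x y; simp [hcon])
  have hx : x ∈ S.verts := (hverts x).2 <| (H.degree_pos_iff_exists_adj x).2 ⟨y, hxy⟩
  have hlt := (averageDegree_coe_le_maxAverageDegree S ⟨x, hx⟩).trans_lt hmad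
  have hdeg : ∀ (v : S.verts) [Fintype (S.coe.neighborSet v)], S.coe.degree v = H.degree v := by
    intro v _
    rw [Subgraph.coe_degree, ← Subgraph.finset_card_neighborSet_eq_degree,
      ← card_neighborFinset_eq_degree]
    congr 1
    ext w
    simp [hadj]
  have hsum : ∑ v : S.verts, (H.degree v : ℝ) = ∑ v, (H.degree v : ℝ) := by
    rw [← Finset.sum_subset (Finset.subset_univ S.verts.toFinset)]
    · exact (Finset.sum_subtype _ (fun v => Set.mem_toFinset) (fun v => (H.degree v : ℝ))).symm
    · intro v _ hv
      have : ¬ 0 < H.degree v := fun h => hv (Set.mem_toFinset.2 ((hverts v).2 h))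
      simp only [Nat.cast_eq_zero]
      omega
  have hcard : Fintype.card S.verts = {v | 0 < H.degree v}.toFinset.card := by
    rw [← Set.toFinset_card]
    congr 1
    ext v
    simp [hverts]
  have hpos : (0 : ℝ) < Fintype.card S.verts := by
    have : Nonempty S.verts := ⟨⟨x, hx⟩⟩
    exact_mod_cast Fintype.card_pos
  simp_rw [averageDegree, hdeg] at hlt
  rw [hsum, div_lt_div_iff₀ hpos (by norm_num), hcard] at hlt
  have : (31 : ℝ) * ∑ v, (H.degree v : ℝ) < 113 * {v | 0 < H.degree v}.toFinset.card := by
    linarith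
  exact_mod_cast this

omit [Fintype V] in
lemma EdgeSees.sees {e e' : G.edgeSet} (h : G.EdgeSees e e') : G.Sees e e' := by
  have hne : e ≠ e' := by
    rintro rfl
    rcases h with h | h <;> simp at h
  refine ⟨fun h' => hne (Subtype.ext h'), ?_⟩
  rcases h with h | h
  · rw [dist_eq_one_iff_adj, lineGraph_adj_iff_exists] at h
    obtain ⟨-, v, hv, hv'⟩ := h
    exact ⟨v, hv, v, hv', Or.inl rfl⟩
  · obtain ⟨p, hp⟩ := (Reachable.of_dist_ne_zero (by rw [h]; norm_num)).exists_walk_length_eq_dist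
    rw [h] at hp
    match p, hp with
    | .cons (v := m) h1 (.cons h2 .nil), _ =>
      rw [lineGraph_adj_iff_exists] at h1 h2
      obtain ⟨-, u, hu, hum⟩ := h1
      obtain ⟨-, w, hwm, hw⟩ := h2
      refine ⟨u, hu, w, hw, or_iff_not_imp_left.2 fun huw => ?_⟩
      have hm : (m : Sym2 V) = s(u, w) := (Sym2.mem_and_mem_iff huw).1 ⟨hum, hwm⟩
      have := m.2
      rwa [hm] at this

end SimpleGraph

theorem theorem2 {V : Type*} [Fintype V] (G : SimpleGraph V)
    (hore : G.oreDegree ≤ 8) (hmad : G.maxAverageDegree < 113 / 31) :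
    G.strongChromaticIndex ≤ 20 := by
  obtain ⟨f, hf⟩ := G.exists_isPartialColoring_empty
    (fun u v h => (SimpleGraph.degree_add_le_oreDegree h).trans hore)
    (fun H hH hbot => SimpleGraph.sum_degree_lt_of_maxAverageDegree_lt hmad hH hbot)
  exact sInf_le ⟨20, rfl, fun e => f e, fun e e' h =>
    hf e e.2 (Finset.notMem_empty _) e' e'.2 (Finset.notMem_empty _) h.sees⟩
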